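/- Let $\mathscr A$ be a (not necessarily unital) $C^*$-algebra and let $\mathscr X$ be a Hilbert $\mathscr A$-module, that is, a complex vector space and right $\mathscr A$-module with $\mu(xa)=(\mu x)a=x(\mu a)$, equipped with an $\mathscr A$-valued inner product $\langle\cdot,\cdot\rangle$ that is $\mathbb C$-linear in the second variable and satisfies $\langle x,ya\rangle=\langle x,y\rangle a$, $\langle x,y\rangle^*=\langle y,x\rangle$, $\langle x,x\rangle\ge 0$, and $\langle x,x\rangle=0$ if and only if $x=0$, such that $\mathscr X$ is complete with respect to the norm $\|x\|=\|\langle x,x\rangle\|^{1/2}$. Let $\mathbb T=\{\lambda\in\mathbb C:|\lambda|=1\}$. For elements $u,v$ of a complex normed space write $u\parallel v$ if $\|u+\lambda v\|=\|u\|+\|v\|$ for some $\lambda\in\mathbb T$. For $a\in\mathscr A$ let $r(a)$ be the spectral radius of $a$ (computed in the unitization of $\mathscr A$ if $\mathscr A$ has no unit). Then for all $x,y\in\mathscr X$ the following statements are mutually equivalent: (i) $x\parallel y$; (ii) $\langle x,x\rangle\parallel\langle x,y\rangle$ and $\|\langle x,y\rangle\|=\|x\|\,\|y\|$; (iii) $r(\langle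 x,y\rangle)=\|\langle x,y\rangle\|=\|x\|\,\|y\|$; (iv) $\|\langle x,x+\lambda y\rangle\|=\|x\|\,(\|x\|+\|y\|)$ for some $\lambda\in\mathbb T$. -/

import Mathlib

open scoped RightActions ENNReal

/-- Two vectors of a complex normed space are *parallel* if `‖x + z y‖ = ‖x‖ + ‖y‖` for some
complex number `z` of modulus one. -/
def Parallel {V : Type*} [NormedAddCommGroup V] [NormedSpace ℂ V] (x y : V) : Prop :=
  ∃ z : ℂ, ‖z‖ = 1 ∧ ‖x + z • y‖ = ‖x‖ + ‖y‖

/-- A (right) Hilbert module over a C⋆-algebra `A`, not assumed unital. The right action of `a` on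
`x` is `x <• a`, and the `A`-valued inner product `inner A x y` is linear in its second variable.
The norm of `X` is the one given by the inner product, and `X` is complete for it.
(Mathlib's `CStarModule` has the left-module convention `inner A x (a • y) = a * inner A x y`
instead, and does not ask for completeness.) -/
class HilbertCStarModule (A X : Type*) [NonUnitalCStarAlgebra A] [NormedAddCommGroup X]
    [NormedSpace ℂ X] [SMul Aᵐᵒᵖ X] extends Inner A X, CompleteSpace X where
  add_rsmul (x y : X) (a : A) : (x + y) <• a = x <• a + y <• a
  rsmul_add (x : X) (a b : A) : x <• (a + b) = x <• a + x <• b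
  rsmul_mul (x : X) (a b : A) : x <• (a * b) = (x <• a) <• b
  smul_rsmul (c : ℂ) (x : X) (a : A) : (c • x) <• a = c • (x <• a)
  rsmul_smul (c : ℂ) (x : X) (a : A) : x <• (c • a) = c • (x <• a)
  inner_add_right (x y z : X) : inner x (y + z) = inner x y + inner x z
  inner_smul_right (c : ℂ) (x y : X) : inner x (c • y) = c • inner x y
  inner_rsmul_right (x y : X) (a : A) : inner x (y <• a) = inner x y * a
  star_inner (x y : X) : star (inner x y) = inner y x
  /-- `⟨x, x⟩` is a positive element of `A`. -/
  inner_self_positive (x : X) : ∃ b : A, inner x x = star b * b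
  inner_self_eq_zero (x : X) : inner x x = 0 ↔ x = 0
  norm_eq_sqrt_norm_inner_self (x : X) : ‖x‖ = √‖inner x x‖

/-- The spectral radius of an element of a possibly non-unital complex algebra: the supremum of
`|k|` over the spectrum of the element, taken in the unitization. (If the algebra already has a
unit, this adds at most the point `0` to the spectrum, so the radius is the usual one.) -/
noncomputable def nonUnitalSpectralRadius {A : Type*} [NonUnitalCStarAlgebra A] (a : A) : ℝ≥0∞ :=
  spectralRadius ℂ (a : Unitization ℂ A)

open Filter Topology

/-! The links among (i), (ii) and (iv) are equality cases of the triangle and Cauchy–Schwarz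
inequalities. The real content concerns (iii): for unit vectors `u`, `v`, `‖u + v‖ = 2` exactly when
`1` lies in the spectrum of `c = ⟨u, v⟩`. With `b = ⟨u, u⟩`, so that `c c* ≤ b ≤ 1`, this becomes a
statement about `‖b + c‖ = 2` in the unitization (`two_le_norm_add_of_not_isUnit`,
`not_isUnit_of_norm_add_eq_two`). Its proof replaces states by unit elements `w n`, testing `p`
through `w* p w`. Rescaling then moves `1` to a spectral value of `⟨x, y⟩` of modulus `‖x‖ ‖y‖`,
whose phase gives the scalar. -/

/-- If `c` is a contraction and `1 - c` is not invertible, then `1` is an approximate eigenvalue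
of left multiplication by `c`. -/
theorem exists_approximate_eigenvector {U : Type*} [CStarAlgebra U] [Nontrivial U] {c : U}
    (hc : ‖c‖ ≤ 1) (h : ¬ IsUnit (1 - c)) :
    ∃ w : ℕ → U, (∀ n, ‖w n‖ = 1) ∧ Tendsto (fun n => (1 - c) * w n) atTop (𝓝 0) := by
  have key : ∀ n : ℕ, ∃ w : U, ‖w‖ = 1 ∧ ‖(1 - c) * w‖ ≤ 2 * (1 / ((n : ℝ) + 1)) := by
    intro n
    set e : ℝ := 1 / ((n : ℝ) + 1) with he
    have he0 : 0 < e := by positivity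
    have he1 : e ≤ 1 := by
      rw [he, div_le_one (by positivity)]
      linarith [n.cast_nonneg (α := ℝ)]
    have hlt : ‖(1 - e) • c‖ < 1 := by
      rw [norm_smul, Real.norm_of_nonneg (by linarith)]
      nlinarith [norm_nonneg c]
    let v : Uˣ := Units.oneSub ((1 - e) • c) hlt
    have hv : (v : U) = 1 - (1 - e) • c := rfl
    have hpos : 0 < ‖(↑v⁻¹ : U)‖ := Units.norm_pos _
    have hdiff : (1 - c) - (v : U) = -(e • c) := by rw [hv, sub_smul, one_smul]; abel
    have hec : ‖e • c‖ ≤ e := by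
      rw [norm_smul, Real.norm_of_nonneg he0.le]
      nlinarith
    -- Otherwise `1 - c`, at distance at most `e` from `v`, would be invertible too. So `v⁻¹` is
    -- large, and normalizing it gives `w`.
    have hinv : ‖(↑v⁻¹ : U)‖⁻¹ ≤ e := by
      by_contra! hcon
      exact h (Units.ofNearby v (1 - c) (by rw [hdiff, norm_neg]; linarith)).isUnit
    refine ⟨‖(↑v⁻¹ : U)‖⁻¹ • (↑v⁻¹ : U), ?_, ?_⟩
    · rw [norm_smul, norm_inv, norm_norm, inv_mul_cancel₀ hpos.ne']
    · have h1 : (1 - c) * (‖(↑v⁻¹ : U)‖⁻¹ • (↑v⁻¹ : U))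
          = ‖(↑v⁻¹ : U)‖⁻¹ • (1 : U) - (e • c) * (‖(↑v⁻¹ : U)‖⁻¹ • (↑v⁻¹ : U)) := by
        rw [show (1 - c : U) = v - e • c by rw [← sub_eq_iff_eq_add'.mp hdiff |>.symm]; abel,
          sub_mul, mul_smul_comm, Units.mul_inv]
      rw [h1]
      refine (norm_sub_le _ _).trans ?_
      have h2 : ‖(e • c) * (‖(↑v⁻¹ : U)‖⁻¹ • (↑v⁻¹ : U))‖ ≤ e := by
        refine (norm_mul_le _ _).trans ?_
        rw [norm_smul (‖(↑v⁻¹ : U)‖⁻¹), norm_inv, norm_norm, inv_mul_cancel₀ hpos.ne', mul_one]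
        exact hec
      have h3 : ‖‖(↑v⁻¹ : U)‖⁻¹ • (1 : U)‖ ≤ e := by
        rw [norm_smul, norm_inv, norm_norm, CStarRing.norm_one, mul_one]
        exact hinv
      linarith
  choose w hw hw' using key
  refine ⟨w, hw, squeeze_zero_norm hw' ?_⟩
  simpa using (tendsto_one_div_add_atTop_nhds_zero_nat (𝕜 := ℝ)).const_mul 2

/-! ### Order estimates along sequences of unit elements -/

section Order

variable {U : Type*} [CStarAlgebra U] {w : ℕ → U}

theorem tendsto_conjugate_of_tendsto_mul (hw : ∀ n, ‖w n‖ = 1) (q p : U)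
    (h : Tendsto (fun n => p * w n) atTop (𝓝 0)) :
    Tendsto (fun n => star (w n) * (q * p) * w n) atTop (𝓝 0) := by
  have h0 : Tendsto (fun n => ‖q‖ * ‖p * w n‖) atTop (𝓝 0) := by
    simpa using h.norm.const_mul ‖q‖
  refine squeeze_zero_norm (fun n => ?_) h0
  calc ‖star (w n) * (q * p) * w n‖ = ‖star (w n) * (q * (p * w n))‖ := by simp only [mul_assoc]
    _ ≤ ‖star (w n)‖ * (‖q‖ * ‖p * w n‖) :=
      (norm_mul_le _ _).trans (by gcongr; exact norm_mul_le _ _)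
    _ = _ := by rw [norm_star, hw, one_mul]

theorem tendsto_conjugate_star {p : U}
    (h : Tendsto (fun n => star (w n) * p * w n) atTop (𝓝 0)) :
    Tendsto (fun n => star (w n) * star p * w n) atTop (𝓝 0) := by
  simpa [mul_assoc] using h.star

variable [PartialOrder U] [StarOrderedRing U]

theorem tendsto_conjugate_of_le {p q : U} (hp : 0 ≤ p) (hpq : p ≤ q)
    (h : Tendsto (fun n => star (w n) * q * w n) atTop (𝓝 0)) :
    Tendsto (fun n => star (w n) * p * w n) atTop (𝓝 0) :=
  squeeze_zero_norm (fun _ => CStarAlgebra.norm_le_norm_of_nonneg_of_le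
    (star_left_conjugate_nonneg hp _) (star_left_conjugate_le_conjugate hpq _)) (by simpa using h.norm)

theorem tendsto_mul_of_star_mul_self_le {p q : U} (hpq : star p * p ≤ q)
    (h : Tendsto (fun n => star (w n) * q * w n) atTop (𝓝 0)) :
    Tendsto (fun n => p * w n) atTop (𝓝 0) := by
  have h1 := (tendsto_conjugate_of_le (star_mul_self_nonneg p) hpq h).norm
  have h2 : ∀ n, ‖star (w n) * (star p * p) * w n‖ = ‖p * w n‖ ^ 2 := fun n => by
    rw [sq, ← CStarRing.norm_star_mul_self, star_mul]
    simp only [mul_assoc]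
  simp only [h2, norm_zero] at h1
  rw [tendsto_zero_iff_norm_tendsto_zero]
  simpa [Real.sqrt_sq] using h1.sqrt

/-- Approximate eigenvectors of `c*`, rather than `c`, give `w* (1 - c c*) w → 0`. Since `c c* ≤ b ≤
1`, also `w* (1 - b) w → 0`, so `w* (b + c) w` approaches `2 w* w`, of norm `2`. -/
theorem two_le_norm_add_of_not_isUnit [Nontrivial U] {b c : U} (hb : b ≤ 1)
    (hcb : c * star c ≤ b) (hc : ‖c‖ ≤ 1) (h : ¬ IsUnit (1 - c)) : 2 ≤ ‖b + c‖ := by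
  have h' : ¬ IsUnit (1 - star c) := by
    rw [← isUnit_star]
    simpa using h
  obtain ⟨w, hw, hlim⟩ := exists_approximate_eigenvector (by rwa [norm_star]) h'
  have h1 := tendsto_conjugate_of_tendsto_mul hw 1 _ hlim
  have h2 := tendsto_conjugate_of_tendsto_mul hw c _ hlim
  have h3 := tendsto_conjugate_star h1
  have h4 : Tendsto (fun n => star (w n) * (1 - c * star c) * w n) atTop (𝓝 0) := by
    have := h3.add h2
    simp only [add_zero] at this
    refine this.congr fun n => ?_
    simp only [one_mul, star_sub, star_one, star_star]
    noncomm_ring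
  have h5 := tendsto_conjugate_of_le (sub_nonneg.2 hb) (sub_le_sub_left hcb 1) h4
  have h6 : Tendsto (fun n => (2 : ℝ) • (star (w n) * w n) - star (w n) * (b + c) * w n) atTop
      (𝓝 0) := by
    have := h3.add h5
    simp only [add_zero] at this
    refine this.congr fun n => ?_
    simp only [one_mul, star_sub, star_one, star_star, two_smul]
    noncomm_ring
  have h7 : ∀ n, 2 - ‖b + c‖ ≤ ‖(2 : ℝ) • (star (w n) * w n) - star (w n) * (b + c) * w n‖ := by
    intro n
    have e1 : ‖(2 : ℝ) • (star (w n) * w n)‖ = 2 := by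
      rw [norm_smul, CStarRing.norm_star_mul_self, hw]
      norm_num
    have e2 : ‖star (w n) * (b + c) * w n‖ ≤ ‖b + c‖ := by
      refine (norm_mul_le _ _).trans ?_
      rw [hw, mul_one]
      refine (norm_mul_le _ _).trans ?_
      rw [norm_star, hw, one_mul]
    have := norm_sub_norm_le ((2 : ℝ) • (star (w n) * w n)) (star (w n) * (b + c) * w n)
    linarith
  have := ge_of_tendsto' h6.norm h7
  rw [norm_zero] at this
  linarith

/-- Approximate eigenvectors of `(b + c)* (b + c)` for its norm `4` satisfy `(b - c) w → 0` by the
parallelogram identity. Then `(1 - b) w → 0`, hence `(1 - c) w → 0`. -/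
theorem not_isUnit_of_norm_add_eq_two [Nontrivial U] {b c : U} (hb0 : 0 ≤ b) (hb : b ≤ 1)
    (hc : ‖c‖ ≤ 1) (h : ‖b + c‖ = 2) : ¬ IsUnit (1 - c) := by
  have hbs : star b = b := (IsSelfAdjoint.of_nonneg hb0).star_eq
  have hsq : b * b ≤ b := by
    have := CStarAlgebra.pow_antitone hb0 hb (show 1 ≤ 2 by norm_num)
    simpa [sq] using this
  have hcc : star c * c ≤ 1 := by
    rw [← CStarAlgebra.norm_le_one_iff_of_nonneg _ (star_mul_self_nonneg c),
      CStarRing.norm_star_mul_self]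
    exact mul_le_one₀ hc (norm_nonneg _) hc
  set d : U := star (b + c) * (b + c) with hd
  have hd0 : 0 ≤ d := star_mul_self_nonneg _
  have hdn : ‖d‖ = 4 := by
    rw [hd, CStarRing.norm_star_mul_self, h]
    norm_num
  have hspec : ¬ IsUnit (1 - (1 / 4 : ℝ) • d) := by
    have h0 : (0 : U) ≤ (1 / 4 : ℝ) • d := smul_nonneg (by norm_num) hd0
    have h1 := CStarAlgebra.norm_mem_spectrum_of_nonneg h0
    rw [norm_smul, hdn, spectrum.mem_iff] at h1
    norm_num at h1
    simpa using h1
  obtain ⟨w, hw, hlim⟩ := exists_approximate_eigenvector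
    (by rw [norm_smul, hdn]; norm_num) hspec
  have h4d : Tendsto (fun n => star (w n) * ((4 : ℝ) • 1 - d) * w n) atTop (𝓝 0) := by
    have := tendsto_conjugate_of_tendsto_mul hw ((4 : ℝ) • 1) _ hlim
    simpa [smul_sub, smul_smul] using this
  have hle : star (b - c) * (b - c) ≤ (4 : ℝ) • 1 - d := by
    have e : (4 : ℝ) • (1 : U) - d - star (b - c) * (b - c)
        = (2 : ℝ) • ((1 - b * b) + (1 - star c * c)) := by
      rw [hd, star_add, star_sub, hbs, show (4 : ℝ) = 2 + 2 by norm_num]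
      simp only [add_smul, two_smul]
      noncomm_ring
    rw [← sub_nonneg, e]
    exact smul_nonneg (by norm_num)
      (add_nonneg (sub_nonneg.2 (hsq.trans hb)) (sub_nonneg.2 hcc))
  have hbc := tendsto_mul_of_star_mul_self_le hle h4d
  have h1 := tendsto_conjugate_of_tendsto_mul hw (star (b + c)) _ hbc
  have h2 := tendsto_conjugate_star h1
  have h3 := tendsto_conjugate_of_tendsto_mul hw (star (b - c)) _ hbc
  -- From `2b = (b + c) + (b - c)`, `4b²` is `d` plus terms containing the factor `b - c` or its
  -- adjoint.
  have h1b : Tendsto (fun n => star (w n) * (1 - b * b) * w n) atTop (𝓝 0) := by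
    have := (((h4d.sub h1).sub h2).sub h3).const_smul (1 / 4 : ℝ)
    simp only [sub_zero, smul_zero] at this
    refine this.congr fun n => ?_
    rw [← sub_mul, ← mul_sub, ← sub_mul, ← mul_sub, ← sub_mul, ← mul_sub, ← smul_mul_assoc,
      ← mul_smul_comm]
    congr 2
    rw [show (4 : ℝ) • (1 : U) - d - star (b + c) * (b - c) - star (star (b + c) * (b - c))
      - star (b - c) * (b - c) = (4 : ℝ) • (1 - b * b) by
        rw [hd, star_mul, star_star, star_add, star_sub, hbs, show (4 : ℝ) = 2 + 2 by norm_num]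
        simp only [add_smul, two_smul]
        noncomm_ring, smul_smul]
    norm_num
  have hb1 : Tendsto (fun n => (1 - b) * w n) atTop (𝓝 0) := by
    refine tendsto_mul_of_star_mul_self_le ?_ h1b
    have e : (1 - b * b) - star (1 - b) * (1 - b) = (2 : ℝ) • (b - b * b) := by
      rw [star_sub, star_one, hbs]
      simp only [two_smul]
      noncomm_ring
    rw [← sub_nonneg, e]
    exact smul_nonneg (by norm_num) (sub_nonneg.2 hsq)
  have hc1 : Tendsto (fun n => (1 - c) * w n) atTop (𝓝 0) := by
    have := hb1.add hbc
    simp only [add_zero] at this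
    refine this.congr fun n => ?_
    noncomm_ring
  rintro ⟨v, hv⟩
  have hw0 : Tendsto w atTop (𝓝 0) := by
    have := hc1.const_mul (↑v⁻¹ : U)
    simp only [mul_zero] at this
    refine this.congr fun n => ?_
    rw [← hv, Units.inv_mul_cancel_left]
  have := hw0.norm
  simp [hw] at this

end Order

/-- For `t ≤ s`, write `s p + t q = s (p + q) - (s - t) q` and use the reverse triangle inequality.
-/
theorem norm_smul_add_smul_of_norm_add {V : Type*} [SeminormedAddCommGroup V] [NormedSpace ℝ V]
    {p q : V} (h : ‖p + q‖ = ‖p‖ + ‖q‖) {s t : ℝ} (hs : 0 ≤ s) (ht : 0 ≤ t) :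
    ‖s • p + t • q‖ = s * ‖p‖ + t * ‖q‖ := by
  have key : ∀ {p q : V} {s t : ℝ}, 0 ≤ t → t ≤ s → ‖p + q‖ = ‖p‖ + ‖q‖ →
      ‖s • p + t • q‖ = s * ‖p‖ + t * ‖q‖ := by
    intro p q s t ht hst h
    have hs := ht.trans hst
    refine le_antisymm ((norm_add_le _ _).trans ?_) ?_
    · rw [norm_smul, norm_smul, Real.norm_of_nonneg hs, Real.norm_of_nonneg ht]
    · have h1 := norm_sub_le (s • p + t • q) (-((s - t) • q))
      rw [show s • p + t • q - -((s - t) • q) = s • (p + q) by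
        rw [sub_smul, smul_add]; abel, norm_neg, norm_smul, norm_smul, h,
        Real.norm_of_nonneg hs, Real.norm_of_nonneg (sub_nonneg.2 hst)] at h1
      linarith
  rcases le_total t s with hst | hst
  · exact key ht hst h
  · rw [add_comm, key hs hst (by rw [add_comm, h, add_comm]), add_comm]

/-! ### Hilbert modules: Cauchy–Schwarz and the spectrum of the inner product -/

namespace HilbertCStarModule

variable {A X : Type*} [NonUnitalCStarAlgebra A] [NormedAddCommGroup X]
    [NormedSpace ℂ X] [SMul Aᵐᵒᵖ X] [HilbertCStarModule A X]

theorem inner_add_left (x y z : X) : inner A (x + y) z = inner A x z + inner A y z := by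
  rw [← star_inner, inner_add_right, star_add, star_inner, star_inner]

theorem inner_smul_left (c : ℂ) (x y : X) : inner A (c • x) y = star c • inner A x y := by
  rw [← star_inner, inner_smul_right, star_smul, star_inner]

theorem inner_rsmul_left (x y : X) (a : A) : inner A (x <• a) y = star a * inner A x y := by
  rw [← star_inner, inner_rsmul_right, star_mul, star_inner]

theorem inner_sub_right (x y z : X) : inner A x (y - z) = inner A x y - inner A x z := by
  rw [eq_sub_iff_add_eq, ← inner_add_right, sub_add_cancel]

theorem inner_sub_left (x y z : X) : inner A (x - y) z = inner A x z - inner A y z := by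
  rw [eq_sub_iff_add_eq, ← inner_add_left, sub_add_cancel]

variable (A) in
theorem norm_inner_self (x : X) : ‖inner A x x‖ = ‖x‖ ^ 2 := by
  rw [norm_eq_sqrt_norm_inner_self (A := A) x, Real.sq_sqrt (norm_nonneg _)]

section Order

variable [PartialOrder (Unitization ℂ A)] [StarOrderedRing (Unitization ℂ A)]

theorem inr_inner_self_nonneg (x : X) : 0 ≤ (inner A x x : Unitization ℂ A) := by
  obtain ⟨b, hb⟩ := inner_self_positive (A := A) x
  rw [hb, Unitization.inr_mul, Unitization.inr_star]
  exact star_mul_self_nonneg _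

theorem inr_inner_self_le_one {x : X} (hx : ‖x‖ ≤ 1) : (inner A x x : Unitization ℂ A) ≤ 1 := by
  rw [← CStarAlgebra.norm_le_one_iff_of_nonneg _ (inr_inner_self_nonneg x),
    Unitization.norm_inr, norm_inner_self]
  exact pow_le_one₀ (norm_nonneg x) hx

/-- The `A`-valued Cauchy–Schwarz inequality, for `y` in the unit ball. -/
theorem inr_inner_mul_star_le (x : X) {y : X} (hy : ‖y‖ ≤ 1) :
    (inner A x y : Unitization ℂ A) * star (inner A x y : Unitization ℂ A)
      ≤ (inner A x x : Unitization ℂ A) := by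
  -- With `c = ⟨x, y⟩`, this gives `⟨x, x⟩ - 2 c c* + c ⟨y, y⟩ c* ≥ 0`; the last term is at most `c
  -- c*`.
  have h := inr_inner_self_nonneg (A := A) (x - y <• inner A y x)
  have h' := star_right_conjugate_le_conjugate (inr_inner_self_le_one (A := A) hy)
    (inner A x y : Unitization ℂ A)
  simp only [inner_sub_right, inner_sub_left, inner_rsmul_right, inner_rsmul_left, star_inner,
    Unitization.inr_sub, Unitization.inr_mul] at h
  rw [← Unitization.inr_star, star_inner, mul_one] at h'
  rw [← Unitization.inr_star, star_inner, ← sub_nonneg]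
  refine (add_nonneg h (sub_nonneg.2 h')).trans_eq ?_
  noncomm_ring

end Order

/-- The Cauchy–Schwarz inequality. -/
theorem norm_inner_le (x y : X) : ‖inner A x y‖ ≤ ‖x‖ * ‖y‖ := by
  let _ := CStarAlgebra.spectralOrder (Unitization ℂ A)
  have := CStarAlgebra.spectralOrderedRing (Unitization ℂ A)
  have key : ∀ v : X, ‖v‖ ≤ 1 → ‖inner A x v‖ ≤ ‖x‖ := by
    intro v hv
    have h := CStarAlgebra.norm_le_norm_of_nonneg_of_le (mul_star_self_nonneg _)
      (inr_inner_mul_star_le (A := A) x hv)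
    rw [CStarRing.norm_self_mul_star, Unitization.norm_inr, Unitization.norm_inr,
      norm_inner_self, ← sq] at h
    exact le_of_sq_le_sq h (norm_nonneg x)
  rcases eq_or_ne y 0 with rfl | hy
  · have : inner A x (0 : X) = 0 := by simpa using inner_sub_right (A := A) x 0 0
    simp [this]
  · have hy' : 0 < ‖y‖ := norm_pos_iff.2 hy
    have h := key (((‖y‖⁻¹ : ℝ) : ℂ) • y) (by
      rw [norm_smul, Complex.norm_real, norm_inv, norm_norm, inv_mul_cancel₀ hy'.ne'])
    rw [inner_smul_right, norm_smul, Complex.norm_real, norm_inv, norm_norm,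
      inv_mul_le_iff₀ hy'] at h
    linarith

/-- `⟨x + y, x + y⟩` has norm `(‖x‖ + ‖y‖)²`, so both summands `⟨x, x + y⟩` and `⟨y, x + y⟩` must
attain their Cauchy–Schwarz bounds. -/
theorem norm_inner_self_add {x y : X} (h : ‖x + y‖ = ‖x‖ + ‖y‖) :
    ‖inner A x (x + y)‖ = ‖x‖ * (‖x‖ + ‖y‖) := by
  have h1 := norm_inner_self A (x + y)
  rw [inner_add_left] at h1
  have h2 := norm_add_le (inner A x (x + y)) (inner A y (x + y))
  have h3 := norm_inner_le (A := A) x (x + y)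
  have h4 := norm_inner_le (A := A) y (x + y)
  rw [h] at h1 h3 h4
  nlinarith

/-- Unit vectors `u`, `v` satisfy `‖u + v‖ = 2` if and only if `1` is in the spectrum of their
inner product. -/
theorem norm_add_eq_two_iff_not_isUnit {u v : X} (hu : ‖u‖ = 1) (hv : ‖v‖ = 1) :
    ‖u + v‖ = 2 ↔ ¬ IsUnit (1 - (inner A u v : Unitization ℂ A)) := by
  let _ := CStarAlgebra.spectralOrder (Unitization ℂ A)
  have := CStarAlgebra.spectralOrderedRing (Unitization ℂ A)
  have hc : ‖(inner A u v : Unitization ℂ A)‖ ≤ 1 := by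
    rw [Unitization.norm_inr]
    simpa [hu, hv] using norm_inner_le (A := A) u v
  have hb := inr_inner_self_le_one (A := A) hu.le
  have hsum : ‖(inner A u u : Unitization ℂ A) + (inner A u v : Unitization ℂ A)‖
      = ‖inner A u (u + v)‖ := by
    rw [← Unitization.inr_add, ← inner_add_right, Unitization.norm_inr]
  constructor
  · intro h
    refine not_isUnit_of_norm_add_eq_two (inr_inner_self_nonneg u) hb hc ?_
    rw [hsum, norm_inner_self_add (by rw [h, hu, hv]; norm_num), hu, hv]
    norm_num
  · intro h
    have h2 := two_le_norm_add_of_not_isUnit hb (inr_inner_mul_star_le u hv.le) hc h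
    rw [hsum] at h2
    have h3 := norm_inner_le (A := A) u (u + v)
    have h4 := norm_add_le u v
    rw [hu] at h3 h4
    rw [hv] at h4
    linarith

theorem parallel_of_norm_inner_self_add {x y : X} {z : ℂ} (hz : ‖z‖ = 1)
    (h : ‖inner A x (x + z • y)‖ = ‖x‖ * (‖x‖ + ‖y‖)) : Parallel x y := by
  rcases eq_or_ne x 0 with rfl | hx
  · exact ⟨1, by simp, by simp⟩
  · refine ⟨z, hz, ?_⟩
    have hx' : 0 < ‖x‖ := norm_pos_iff.2 hx
    have h1 := norm_inner_le (A := A) x (x + z • y)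
    have h2 := norm_add_le x (z • y)
    rw [norm_smul, hz, one_mul] at h2
    rw [h] at h1
    exact le_antisymm h2 (le_of_mul_le_mul_left h1 hx')

/-- For nonzero `x`, `y` and `‖z‖ = 1`, the vectors `x` and `z • y` satisfy the triangle equality
if and only if `z⁻¹ ‖x‖ ‖y‖` is in the spectrum of `⟨x, y⟩`. -/
theorem norm_add_smul_eq_iff_mem_spectrum {x y : X} (hx : x ≠ 0) (hy : y ≠ 0) {z : ℂ}
    (hz : ‖z‖ = 1) : ‖x + z • y‖ = ‖x‖ + ‖y‖ ↔
      z⁻¹ * (‖x‖ * ‖y‖ : ℝ) ∈ spectrum ℂ (inner A x y : Unitization ℂ A) := by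
  have hx' : 0 < ‖x‖ := norm_pos_iff.2 hx
  have hy' : 0 < ‖y‖ := norm_pos_iff.2 hy
  have hz0 : z ≠ 0 := by rintro rfl; simp at hz
  have hxc : (‖x‖ : ℂ) ≠ 0 := by exact_mod_cast hx'.ne'
  have hyc : (‖y‖ : ℂ) ≠ 0 := by exact_mod_cast hy'.ne'
  have hzy : ‖z • y‖ = ‖y‖ := by rw [norm_smul, hz, one_mul]
  set u : X := ‖x‖⁻¹ • x with hu
  set v : X := ‖y‖⁻¹ • z • y with hv
  have hun : ‖u‖ = 1 := by
    rw [hu, norm_smul, norm_inv, norm_norm, inv_mul_cancel₀ hx'.ne']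
  have hvn : ‖v‖ = 1 := by
    rw [hv, norm_smul, hzy, norm_inv, norm_norm, inv_mul_cancel₀ hy'.ne']
  have hscale : ‖x + z • y‖ = ‖x‖ + ‖y‖ ↔ ‖u + v‖ = 2 := by
    constructor
    · intro h
      rw [hu, hv, norm_smul_add_smul_of_norm_add (by rw [h, hzy]) (by positivity) (by positivity),
        hzy, inv_mul_cancel₀ hx'.ne', inv_mul_cancel₀ hy'.ne']
      norm_num
    · intro h
      have := norm_smul_add_smul_of_norm_add (p := u) (q := v) (by rw [h, hun, hvn]; norm_num)
        hx'.le hy'.le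
      rwa [hun, hvn, hu, hv, smul_inv_smul₀ hx'.ne', smul_inv_smul₀ hy'.ne', mul_one,
        mul_one] at this
  set k : ℂ := z⁻¹ * (‖x‖ * ‖y‖ : ℝ) with hk
  have hk0 : k ≠ 0 := by
    rw [hk]
    push_cast
    exact mul_ne_zero (inv_ne_zero hz0) (mul_ne_zero hxc hyc)
  have hin : inner A u v = k⁻¹ • inner A x y := by
    rw [hu, hv, ← Complex.coe_smul, ← Complex.coe_smul, inner_smul_left, inner_smul_right,
      inner_smul_right, smul_smul, smul_smul, hk]
    congr 1
    push_cast
    simp only [star_inv₀, RCLike.star_def, Complex.conj_ofReal]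
    field_simp
  have hunit : algebraMap ℂ (Unitization ℂ A) k - (inner A x y : Unitization ℂ A)
      = (Units.mk0 k hk0) • (1 - (inner A u v : Unitization ℂ A)) := by
    rw [Units.smul_mk0, hin, Unitization.inr_smul, smul_sub, smul_inv_smul₀ hk0,
      Algebra.algebraMap_eq_smul_one]
  rw [hscale, norm_add_eq_two_iff_not_isUnit (A := A) hun hvn, spectrum.mem_iff, hunit,
    isUnit_smul_iff]

theorem parallel_iff_spectralRadius {x y : X} (hx : x ≠ 0) (hy : y ≠ 0)
    (h : ‖inner A x y‖ = ‖x‖ * ‖y‖) : Parallel x y ↔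
      nonUnitalSpectralRadius (inner A x y) = ENNReal.ofReal ‖inner A x y‖ := by
  have hpos : 0 < ‖x‖ * ‖y‖ := mul_pos (norm_pos_iff.2 hx) (norm_pos_iff.2 hy)
  have hpc : ((‖x‖ * ‖y‖ : ℝ) : ℂ) ≠ 0 := by exact_mod_cast hpos.ne'
  have hnn : ENNReal.ofReal ‖inner A x y‖ = ‖(inner A x y : Unitization ℂ A)‖₊ := by
    rw [Unitization.nnnorm_inr, ofReal_norm, enorm_eq_nnnorm]
  rw [hnn, nonUnitalSpectralRadius]
  constructor
  · rintro ⟨z, hz, hxy⟩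
    have hmem := (norm_add_smul_eq_iff_mem_spectrum (A := A) hx hy hz).1 hxy
    refine le_antisymm (spectrum.spectralRadius_le_nnnorm _) ?_
    refine le_trans (le_of_eq ?_) (le_iSup₂ (α := ℝ≥0∞) _ hmem)
    norm_cast
    ext
    rw [coe_nnnorm, coe_nnnorm, Unitization.norm_inr, h, norm_mul, norm_inv, hz, inv_one, one_mul,
      Complex.norm_real, Real.norm_of_nonneg hpos.le]
  · intro hr
    obtain ⟨k, hk, hkr⟩ := spectrum.exists_nnnorm_eq_spectralRadius
      (inner A x y : Unitization ℂ A)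
    have hkn : ‖k‖ = ‖x‖ * ‖y‖ := by
      rw [hr] at hkr
      rw [← h, ← Unitization.norm_inr (𝕜 := ℂ) (inner A x y)]
      exact congrArg NNReal.toReal (ENNReal.coe_injective hkr)
    have hk0 : k ≠ 0 := by
      rw [← norm_pos_iff, hkn]
      exact hpos
    have hz : ‖(‖x‖ * ‖y‖ : ℝ) * k⁻¹‖ = 1 := by
      rw [norm_mul, norm_inv, hkn, Complex.norm_real, Real.norm_of_nonneg hpos.le,
        mul_inv_cancel₀ hpos.ne']
    -- This is the `z` for which `z⁻¹ ‖x‖ ‖y‖` equals `k`, a spectral value of maximal modulus.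
    refine ⟨(‖x‖ * ‖y‖ : ℝ) * k⁻¹, hz, ?_⟩
    rw [norm_add_smul_eq_iff_mem_spectrum (A := A) hx hy hz]
    rwa [mul_inv, inv_inv, mul_assoc, mul_comm k, ← mul_assoc, inv_mul_cancel₀ hpc, one_mul]

end HilbertCStarModule

open HilbertCStarModule in
theorem mainTheorem6 {A X : Type*} [NonUnitalCStarAlgebra A] [NormedAddCommGroup X]
    [NormedSpace ℂ X] [SMul Aᵐᵒᵖ X] [HilbertCStarModule A X] (x y : X) :
    List.TFAE [
      Parallel x y,
      Parallel (inner A x x) (inner A x y) ∧ ‖inner A x y‖ = ‖x‖ * ‖y‖,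
      nonUnitalSpectralRadius (inner A x y) = ENNReal.ofReal ‖inner A x y‖ ∧
        ‖inner A x y‖ = ‖x‖ * ‖y‖,
      ∃ z : ℂ, ‖z‖ = 1 ∧ ‖inner A x (x + z • y)‖ = ‖x‖ * (‖x‖ + ‖y‖)] := by
  have h14 : Parallel x y →
      ∃ z : ℂ, ‖z‖ = 1 ∧ ‖inner A x (x + z • y)‖ = ‖x‖ * (‖x‖ + ‖y‖) := by
    rintro ⟨z, hz, h⟩
    have hzy : ‖z • y‖ = ‖y‖ := by rw [norm_smul, hz, one_mul]
    refine ⟨z, hz, ?_⟩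
    rw [norm_inner_self_add (by rw [h, hzy]), hzy]
  have h42 : (∃ z : ℂ, ‖z‖ = 1 ∧ ‖inner A x (x + z • y)‖ = ‖x‖ * (‖x‖ + ‖y‖)) →
      Parallel (inner A x x) (inner A x y) ∧ ‖inner A x y‖ = ‖x‖ * ‖y‖ := by
    rintro ⟨z, hz, h⟩
    rw [HilbertCStarModule.inner_add_right, HilbertCStarModule.inner_smul_right] at h
    have h1 := norm_add_le (inner A x x) (z • inner A x y)
    have h2 := norm_inner_le (A := A) x y
    have h3 := norm_inner_self A x
    rw [norm_smul, hz, one_mul] at h1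
    have h4 : ‖inner A x y‖ = ‖x‖ * ‖y‖ := by nlinarith
    refine ⟨⟨z, hz, ?_⟩, h4⟩
    rw [h, h3, h4]
    ring
  tfae_have 1 → 4 := h14
  tfae_have 4 → 2 := h42
  tfae_have 2 → 4 := by
    rintro ⟨⟨z, hz, h⟩, hn⟩
    refine ⟨z, hz, ?_⟩
    rw [HilbertCStarModule.inner_add_right, HilbertCStarModule.inner_smul_right, h, hn,
      norm_inner_self]
    ring
  tfae_have 4 → 1 := fun ⟨_, hz, h⟩ => parallel_of_norm_inner_self_add hz h
  tfae_have 1 ↔ 3 := by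
    by_cases h0 : x = 0 ∨ y = 0
    · have hxy : ‖x‖ * ‖y‖ = 0 := by simpa using h0
      have hin : inner A x y = 0 := by
        have := norm_inner_le (A := A) x y
        rwa [hxy, norm_le_zero_iff] at this
      refine iff_of_true ⟨1, by simp, ?_⟩ ⟨?_, by rw [hin, norm_zero, hxy]⟩
      · rcases h0 with rfl | rfl <;> simp
      · rw [hin, nonUnitalSpectralRadius]
        simp
    · push Not at h0
      have hiff := parallel_iff_spectralRadius (A := A) h0.1 h0.2
      exact ⟨fun h => ⟨(hiff (h42 (h14 h)).2).1 h, (h42 (h14 h)).2⟩, fun h => (hiff h.2).2 h.1⟩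
  tfae_finish
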